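/- **Setting.** Let $\Delta>0$ and $0<m\le M$, and put $\theta=M/m$. Let $\mathcal G$ be a nonempty family of revenue functions $g:[0,\Delta]\to\mathbb R$ such that each $g\in\mathcal G$ is concave, increasing (in the weak sense) and differentiable on $[0,\Delta]$, with $g(0)=0$ and base price $g'(0)\in[m,M]$. An input is a finite sequence $\sigma=(g_1,\dots,g_T)$, $T\ge 1$, of elements of $\mathcal G$, and $\sigma^{[1:t]}=(g_1,\dots,g_t)$. Its optimal offline revenue is $$\eta_{OPT}(\sigma)=\max\Big\{\sum_{t=1}^T g_t(v_t)\;:\; v_t\ge 0,\ \sum_{t=1}^T v_t\le\Delta\Big\}.$$ A deterministic online algorithm $\mathcal A$ chooses $v_t\ge0$ as a function of $\sigma^{[1:t]}$ only ($T$ is not known in advance), subject to $\sum_{t=1}^T v_t\le\Delta$ for every input; its revenue is $\eta_{\mathcal A}(\sigma)=\sum_t g_t(v_t)$ and its competitive ratio is $\sup_\sigma \eta_{OPT}(\sigma)/\eta_{\mathcal A}(\sigma)\in[1,\infty]$. Let $\pi^*$ be the infimum of the competitive ratios of all deterministic online algorithms. For $\pi\ge1$, CR-Pursuit$(\pi)$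 outputs in slot $t$ a quantity $\bar v_t\in[0,\Delta]$ with $$g_t(\bar v_t)=\frac1\pi\big[\eta_{OPT}(\sigma^{[1:t]})-\eta_{OPT}(\sigma^{[1:t-1]})\big],$$ and it is called feasible if $\Phi_\Delta(\pi)=\sup_\sigma\sum_{t}\bar v_t(\sigma)\le\Delta$. For each $g\in\mathcal G$ let $\hat v=\hat v(g)\in[0,\Delta]$ be a maximizer of $g$ on $[0,\Delta]$, and let $$c=\sup_{g\in\mathcal G}\frac{g'(0)}{g(\hat v)/\hat v}\in[1,\infty].$$ **Theorem.** The optimal competitive ratio satisfies $$\pi^*\le c\,(\ln\theta+1),$$ and, if $\mathcal G$ contains every linear function $v\mapsto pv$ with $p\in[m,M]$ (so that the problem covers one-way trading), also $$\ln\theta+1\le\pi^*.$$ Moreover, if $c<\infty$, then with $\bar\pi=c(\ln\theta+1)$ the required quantities of CR-Pursuit$(\bar\pi)$ always exist, CR-Pursuit$(\bar\pi)$ is feasible, and it is $\bar\pi$-competitive, i.e. $\max_\sigma \eta_{OPT}(\sigma)/\eta_{\mathcal A}(\sigma)=\bar\pi$ for $\mathcal A=$ CR-Pursuit$(\bar\pi)$.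 -/

import Mathlib

open Set
open scoped ENNReal

noncomputable section

namespace OOIC

/-- A revenue function for inventory `Δ` and base prices in `[m, M]`: it is concave, increasing
(in the weak sense: selling more never decreases revenue) and differentiable on `[0, Δ]`, vanishes
at `0`, and its (one-sided) derivative at `0`, the base price, lies in `[m, M]`. Only the values on
`[0, Δ]` matter. -/
structure IsRevenueFunction (Δ m M : ℝ) (g : ℝ → ℝ) : Prop where
  concaveOn : ConcaveOn ℝ (Icc 0 Δ) g
  monotoneOn : MonotoneOn g (Icc 0 Δ)
  differentiableOn : DifferentiableOn ℝ g (Icc 0 Δ)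
  map_zero : g 0 = 0
  basePrice_mem : derivWithin g (Icc 0 Δ) 0 ∈ Icc m M

/-- The base price `g'(0)` of a revenue function on `[0, Δ]`. -/
def basePrice (Δ : ℝ) (g : ℝ → ℝ) : ℝ := derivWithin g (Icc 0 Δ) 0

/-- The offline-feasible selling quantities over `T` slots with inventory `Δ`. -/
def feasibleQuantities (Δ : ℝ) (T : ℕ) : Set (Fin T → ℝ) :=
  {v | (∀ t, 0 ≤ v t) ∧ ∑ t, v t ≤ Δ}

/-- The optimal offline revenue `η_OPT(σ)` of a finite input sequence `σ`. -/
def offlineOpt (Δ : ℝ) {T : ℕ} (σ : Fin T → ℝ → ℝ) : ℝ :=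
  sSup ((fun v : Fin T → ℝ => ∑ t, σ t (v t)) '' feasibleQuantities Δ T)

/-- A deterministic online rule: the quantity sold in slot number `t` is a function of the revenue
functions of the slots `1, …, t` only (in particular the horizon `T` is not known to it). -/
abbrev OnlineAlgorithm : Type := (t : ℕ) → (Fin t → ℝ → ℝ) → ℝ

/-- The quantity that `A` sells in slot `t` under the input `σ`. Slots are indexed from `0` by
`Fin T`, so the inputs seen when deciding in slot `t` are the first `t + 1` entries of `σ`. -/
def decision (A : OnlineAlgorithm) {T : ℕ} (σ : Fin T → ℝ → ℝ) (t : Fin T) : ℝ :=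
  A (t + 1) (Fin.take (t + 1) t.isLt σ)

/-- The total quantity that `A` sells under the input `σ`. -/
def totalSold (A : OnlineAlgorithm) {T : ℕ} (σ : Fin T → ℝ → ℝ) : ℝ :=
  ∑ t, decision A σ t

/-- The revenue `η_A(σ)` of `A` under the input `σ`. -/
def revenue (A : OnlineAlgorithm) {T : ℕ} (σ : Fin T → ℝ → ℝ) : ℝ :=
  ∑ t, σ t (decision A σ t)

/-- `A` respects the constraints of the problem on every input sequence from the family `G`. -/
def Respects (Δ : ℝ) (G : Set (ℝ → ℝ)) (A : OnlineAlgorithm) : Prop :=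
  ∀ (T : ℕ) (σ : Fin T → ℝ → ℝ), (∀ t, σ t ∈ G) →
    (∀ t, 0 ≤ decision A σ t) ∧ totalSold A σ ≤ Δ

/-- All offline-to-online revenue ratios `η_OPT(σ) / η_A(σ)`, over all nonempty finite input
sequences `σ` from `G`, as extended nonnegative reals (the ratio is `∞` if `A` earns nothing). -/
def ratios (Δ : ℝ) (G : Set (ℝ → ℝ)) (A : OnlineAlgorithm) : Set ℝ≥0∞ :=
  {r | ∃ (T : ℕ) (σ : Fin T → ℝ → ℝ), 0 < T ∧ (∀ t, σ t ∈ G) ∧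
    r = ENNReal.ofReal (offlineOpt Δ σ) / ENNReal.ofReal (revenue A σ)}

/-- The competitive ratio of `A`: the worst-case offline-to-online revenue ratio. -/
def competitiveRatio (Δ : ℝ) (G : Set (ℝ → ℝ)) (A : OnlineAlgorithm) : ℝ≥0∞ :=
  sSup (ratios Δ G A)

/-- `A` is `π`-competitive: `π` is the maximum of the offline-to-online revenue ratios of `A`. -/
def IsCompetitive (Δ : ℝ) (G : Set (ℝ → ℝ)) (A : OnlineAlgorithm) (π : ℝ) : Prop :=
  IsGreatest (ratios Δ G A) (ENNReal.ofReal π)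

/-- The optimal competitive ratio `π*` over all deterministic online algorithms that respect the
inventory constraint. -/
def optimalRatio (Δ : ℝ) (G : Set (ℝ → ℝ)) : ℝ≥0∞ :=
  sInf {r | ∃ A : OnlineAlgorithm, Respects Δ G A ∧ r = competitiveRatio Δ G A}

/-- `A` is an instance of CR-Pursuit(`π`) on inputs from `G`: in every slot `t` it outputs a
quantity in `[0, Δ]` with
`g_t(v_t) = (1 / π) * (η_OPT(g_1, …, g_t) - η_OPT(g_1, …, g_{t-1}))`.
The total quantity sold is not required to be at most `Δ`. -/
def IsCRPursuit (Δ : ℝ) (G : Set (ℝ → ℝ)) (π : ℝ) (A : OnlineAlgorithm) : Prop :=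
  ∀ (T : ℕ) (σ : Fin T → ℝ → ℝ), (∀ t, σ t ∈ G) → ∀ t : Fin T,
    decision A σ t ∈ Icc 0 Δ ∧
    σ t (decision A σ t) =
      1 / π * (offlineOpt Δ (Fin.take (t + 1) t.isLt σ) - offlineOpt Δ (Fin.take t t.isLt.le σ))

/-- `Φ_Δ(π)`: the worst-case total quantity sold by CR-Pursuit(`π`), over all inputs from `G` (and
over all admissible choices of the quantities, should the defining equations have several
solutions). -/
def worstCaseInventory (Δ : ℝ) (G : Set (ℝ → ℝ)) (π : ℝ) : EReal :=
  sSup {x | ∃ (A : OnlineAlgorithm) (T : ℕ) (σ : Fin T → ℝ → ℝ),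
    IsCRPursuit Δ G π A ∧ (∀ t, σ t ∈ G) ∧ x = (totalSold A σ : EReal)}

/-- CR-Pursuit(`π`) is feasible: `Φ_Δ(π) ≤ Δ`. -/
def CRPursuitFeasible (Δ : ℝ) (G : Set (ℝ → ℝ)) (π : ℝ) : Prop :=
  worstCaseInventory Δ G π ≤ (Δ : EReal)

/-- The constant `c = sup_{g ∈ G} g'(0) / (g(v̂) / v̂)`, where `vhat g` is the chosen maximizer `v̂`
of `g` over `[0, Δ]`; it may be infinite. -/
def familyConstant (Δ : ℝ) (G : Set (ℝ → ℝ)) (vhat : (ℝ → ℝ) → ℝ) : ℝ≥0∞ :=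
  ⨆ g ∈ G, ENNReal.ofReal (basePrice Δ g / (g (vhat g) / vhat g))

end OOIC

end

namespace OOIC

/-! Upper bound. Let `a_t` be the growth of the offline optimum in slot `t` and `p_t` the base price
there. CR-Pursuit earns `a_t / π` in slot `t`, so its revenue telescopes to the optimum divided by
`π`, and only its use of inventory is in question. Up to its maximizer a concave revenue function
stays above the line of slope `p_t / c`, so slot `t` uses at most `(c / π) * (a_t / p_t)`
(`IsCRPursuit.decision_le`). It remains to bound `∑ a_t / p_t` by `Δ (ln θ + 1)`. Since `1 / p = 1 /
M + ∫_p^M l⁻² dl`, it is enough that, for every `l`, the slots with price below `l` have total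
growth at most `l Δ` (`sum_div_le_of_forall_sum_le`). This is submodularity: erasing other slots
never lowers the gain of a slot (`offlineOpt_sub_init_le_mask`), so that total is at most the
optimum of the input with the expensive slots erased. Erased slots become the zero function, which
has no admissible base price; hence the wider class below.

Lower bound. On rising linear prices every prefix is itself an input, so an algorithm of ratio `r`
must have earned `p_k Δ / r` after slot `k`. Summation by parts turns this into a lower bound on the
inventory sold (`mul_sum_le_sum_sub`), and fine geometric price grids from `m` to `M` give `ln θ +
1` in the limit. -/

/-- A concave, nondecreasing function on `[0, Δ]` that vanishes at `0`. Unlike revenue functions,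
this class contains the zero function. -/
structure IsConcaveRevenue (Δ : ℝ) (g : ℝ → ℝ) : Prop where
  concaveOn : ConcaveOn ℝ (Icc 0 Δ) g
  monotoneOn : MonotoneOn g (Icc 0 Δ)
  map_zero : g 0 = 0

lemma IsRevenueFunction.isConcaveRevenue {Δ m M : ℝ} {g : ℝ → ℝ}
    (h : IsRevenueFunction Δ m M g) : IsConcaveRevenue Δ g :=
  ⟨h.concaveOn, h.monotoneOn, h.map_zero⟩

lemma isConcaveRevenue_zero (Δ : ℝ) : IsConcaveRevenue Δ (fun _ => 0) :=
  ⟨concaveOn_const 0 (convex_Icc 0 Δ), fun _ _ _ _ _ => le_rfl, rfl⟩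

lemma IsConcaveRevenue.nonneg {Δ : ℝ} {g : ℝ → ℝ} (h : IsConcaveRevenue Δ g) {v : ℝ}
    (hv : v ∈ Icc 0 Δ) : 0 ≤ g v :=
  h.map_zero ▸ h.monotoneOn ⟨le_rfl, hv.1.trans hv.2⟩ hv hv.1

lemma mem_Icc_of_mem_feasibleQuantities {x : ℝ} {n : ℕ} {v : Fin n → ℝ}
    (hv : v ∈ feasibleQuantities x n) (t : Fin n) : v t ∈ Icc 0 x :=
  ⟨hv.1 t, (Finset.single_le_sum (fun i _ => hv.1 i) (Finset.mem_univ t)).trans hv.2⟩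

lemma zero_mem_feasibleQuantities {x : ℝ} (hx : 0 ≤ x) (n : ℕ) :
    (fun _ => 0) ∈ feasibleQuantities x n :=
  ⟨fun _ => le_rfl, by simpa using hx⟩

/-! ### The offline optimum as a function of the inventory. -/

section Optimum

variable {Δ : ℝ} {n : ℕ} {σ : Fin n → ℝ → ℝ}

lemma bddAbove_revenues (hσ : ∀ t, IsConcaveRevenue Δ (σ t)) {x : ℝ} (hx : x ≤ Δ) :
    BddAbove ((fun v : Fin n → ℝ => ∑ t, σ t (v t)) '' feasibleQuantities x n) := by
  refine ⟨∑ t, σ t Δ, ?_⟩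
  rintro _ ⟨v, hv, rfl⟩
  refine Finset.sum_le_sum fun t _ => ?_
  have h := mem_Icc_of_mem_feasibleQuantities hv t
  exact (hσ t).monotoneOn ⟨h.1, h.2.trans hx⟩ ⟨(h.1.trans h.2).trans hx, le_rfl⟩ (h.2.trans hx)

lemma le_offlineOpt (hσ : ∀ t, IsConcaveRevenue Δ (σ t)) {x : ℝ} (hx : x ≤ Δ) {v : Fin n → ℝ}
    (hv : v ∈ feasibleQuantities x n) : ∑ t, σ t (v t) ≤ offlineOpt x σ :=
  le_csSup (bddAbove_revenues hσ hx) ⟨v, hv, rfl⟩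

lemma offlineOpt_le {x : ℝ} (hx : 0 ≤ x) {B : ℝ}
    (h : ∀ v ∈ feasibleQuantities x n, ∑ t, σ t (v t) ≤ B) : offlineOpt x σ ≤ B := by
  refine csSup_le ⟨_, _, zero_mem_feasibleQuantities hx n, rfl⟩ ?_
  rintro _ ⟨v, hv, rfl⟩
  exact h v hv

lemma offlineOpt_nonneg (hσ : ∀ t, IsConcaveRevenue Δ (σ t)) {x : ℝ} (hx : x ∈ Icc 0 Δ) :
    0 ≤ offlineOpt x σ := by
  have := le_offlineOpt hσ hx.2 (zero_mem_feasibleQuantities hx.1 n)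
  simpa [(hσ _).map_zero] using this

lemma offlineOpt_fin_zero {x : ℝ} (hx : 0 ≤ x) (σ : Fin 0 → ℝ → ℝ) : offlineOpt x σ = 0 := by
  have : feasibleQuantities x 0 = {fun i => i.elim0} := by
    ext v
    simp [feasibleQuantities, hx, Subsingleton.elim v (fun i => i.elim0)]
  simp [offlineOpt, this]

/-- A convex combination of feasible allocations is feasible for the combined inventory. The two
suprema are taken one after the other, so attainment is never needed. -/
lemma concaveOn_offlineOpt (hσ : ∀ t, IsConcaveRevenue Δ (σ t)) :
    ConcaveOn ℝ (Icc 0 Δ) (fun x => offlineOpt x σ) := by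
  refine concaveOn_iff_forall_pos.2 ⟨convex_Icc 0 Δ, fun x hx y hy a b ha hb hab => ?_⟩
  simp only [smul_eq_mul]
  have hxy : a * x + b * y ≤ Δ := by
    simpa using ((convex_Icc 0 Δ) hx hy ha.le hb.le hab).2
  have key : ∀ v ∈ feasibleQuantities x n, ∀ w ∈ feasibleQuantities y n,
      a * ∑ t, σ t (v t) + b * ∑ t, σ t (w t) ≤ offlineOpt (a * x + b * y) σ := by
    intro v hv w hw
    have hu : (fun t => a * v t + b * w t) ∈ feasibleQuantities (a * x + b * y) n := by
      refine ⟨fun t => add_nonneg (mul_nonneg ha.le (hv.1 t)) (mul_nonneg hb.le (hw.1 t)), ?_⟩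
      rw [Finset.sum_add_distrib, ← Finset.mul_sum, ← Finset.mul_sum]
      exact add_le_add (mul_le_mul_of_nonneg_left hv.2 ha.le) (mul_le_mul_of_nonneg_left hw.2 hb.le)
    refine le_trans ?_ (le_offlineOpt hσ hxy hu)
    rw [Finset.mul_sum, Finset.mul_sum, ← Finset.sum_add_distrib]
    refine Finset.sum_le_sum fun t _ => ?_
    have h1 := mem_Icc_of_mem_feasibleQuantities hv t
    have h2 := mem_Icc_of_mem_feasibleQuantities hw t
    simpa using (hσ t).concaveOn.2 ⟨h1.1, h1.2.trans hx.2⟩ ⟨h2.1, h2.2.trans hy.2⟩ ha.le hb.le hab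
  have h1 : ∀ v ∈ feasibleQuantities x n, a * ∑ t, σ t (v t) + b * offlineOpt y σ ≤
      offlineOpt (a * x + b * y) σ := by
    intro v hv
    have : offlineOpt y σ ≤ (offlineOpt (a * x + b * y) σ - a * ∑ t, σ t (v t)) / b :=
      offlineOpt_le hy.1 fun w hw => by
        rw [le_div_iff₀ hb]
        linarith [key v hv w hw]
    rw [le_div_iff₀ hb] at this
    linarith
  have : offlineOpt x σ ≤ (offlineOpt (a * x + b * y) σ - b * offlineOpt y σ) / a :=
    offlineOpt_le hx.1 fun v hv => by
      rw [le_div_iff₀ ha]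
      linarith [h1 v hv]
  rw [le_div_iff₀ ha] at this
  linarith

end Optimum

/-! ### Dynamic programming on the last slot. -/

section Recursion

variable {Δ : ℝ} {n : ℕ} {σ : Fin (n + 1) → ℝ → ℝ}

lemma last_add_offlineOpt_init_le (hσ : ∀ t, IsConcaveRevenue Δ (σ t)) {x u : ℝ} (hx : x ≤ Δ)
    (hu : u ∈ Icc 0 x) :
    σ (Fin.last n) u + offlineOpt (x - u) (Fin.init σ) ≤ offlineOpt x σ := by
  suffices offlineOpt (x - u) (Fin.init σ) ≤ offlineOpt x σ - σ (Fin.last n) u by linarith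
  refine offlineOpt_le (by linarith [hu.2]) fun v hv => ?_
  have hw : (Fin.snoc v u : Fin (n + 1) → ℝ) ∈ feasibleQuantities x (n + 1) := by
    refine ⟨fun t => ?_, ?_⟩
    · refine Fin.lastCases ?_ (fun i => ?_) t
      · simpa using hu.1
      · simpa using hv.1 i
    · simp only [Fin.sum_univ_castSucc, Fin.snoc_castSucc, Fin.snoc_last]
      linarith [hv.2]
  have := le_offlineOpt hσ hx hw
  simp only [Fin.sum_univ_castSucc, Fin.snoc_castSucc, Fin.snoc_last] at this
  simp only [Fin.init]
  linarith

/-- With `last_add_offlineOpt_init_le`, this is the Bellman equation for the optimum, stated as a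
least upper bound so that no optimal allocation has to exist. -/
lemma offlineOpt_le_of_forall_last (hσ : ∀ t, IsConcaveRevenue Δ (σ t)) {x B : ℝ}
    (hx : x ∈ Icc 0 Δ)
    (h : ∀ u ∈ Icc 0 x, σ (Fin.last n) u + offlineOpt (x - u) (Fin.init σ) ≤ B) :
    offlineOpt x σ ≤ B := by
  refine offlineOpt_le hx.1 fun v hv => ?_
  have hu := mem_Icc_of_mem_feasibleQuantities hv (Fin.last n)
  have hw : Fin.init v ∈ feasibleQuantities (x - v (Fin.last n)) n := by
    refine ⟨fun t => hv.1 _, ?_⟩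
    have := hv.2
    rw [Fin.sum_univ_castSucc] at this
    simp only [Fin.init]
    linarith
  have h1 := le_offlineOpt (σ := Fin.init σ) (fun t => hσ t.castSucc)
    (by linarith [hu.1, hx.2]) hw
  have h2 := h _ hu
  rw [Fin.sum_univ_castSucc]
  simp only [Fin.init] at h1 h2 ⊢
  linarith

lemma offlineOpt_init_le (hσ : ∀ t, IsConcaveRevenue Δ (σ t)) {x : ℝ} (hx : x ∈ Icc 0 Δ) :
    offlineOpt x (Fin.init σ) ≤ offlineOpt x σ := by
  have := last_add_offlineOpt_init_le hσ hx.2 (u := 0) ⟨le_rfl, hx.1⟩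
  simpa [(hσ _).map_zero] using this

lemma offlineOpt_mono {σ : Fin n → ℝ → ℝ} (hσ : ∀ t, IsConcaveRevenue Δ (σ t)) {x y : ℝ}
    (hx : 0 ≤ x) (hxy : x ≤ y) (hy : y ≤ Δ) : offlineOpt x σ ≤ offlineOpt y σ :=
  offlineOpt_le hx fun _ hv => le_offlineOpt hσ hy ⟨hv.1, hv.2.trans hxy⟩

lemma offlineOpt_le_last_add (hσ : ∀ t, IsConcaveRevenue Δ (σ t)) {x : ℝ} (hx : x ∈ Icc 0 Δ) :
    offlineOpt x σ ≤ σ (Fin.last n) x + offlineOpt x (Fin.init σ) :=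
  offlineOpt_le_of_forall_last hσ hx fun u hu => by
    have h1 : u ∈ Icc 0 Δ := ⟨hu.1, hu.2.trans hx.2⟩
    have h2 := offlineOpt_mono (σ := Fin.init σ) (x := x - u) (y := x) (fun t => hσ t.castSucc)
      (by linarith [hu.2]) (by linarith [hu.1]) hx.2
    linarith [(hσ (Fin.last n)).monotoneOn h1 hx hu.2]

end Recursion

/-! ### Submodularity of the offline optimum. -/

/-- The increments of a concave function over intervals of a fixed length decrease. -/
lemma concaveOn_add_le_add {s : Set ℝ} {f : ℝ → ℝ} (hf : ConcaveOn ℝ s f) {x y z w : ℝ}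
    (hx : x ∈ s) (hw : w ∈ s) (hxy : x ≤ y) (hxz : x ≤ z) (h : x + w = y + z) :
    f x + f w ≤ f y + f z := by
  rcases eq_or_lt_of_le (show x ≤ w by linarith) with hxw | hxw
  · have : y = x := by linarith
    have : z = x := by linarith
    subst hxw; simp_all
  have hd : 0 < w - x := by linarith
  have p1 : 0 ≤ (w - y) / (w - x) := div_nonneg (by linarith) hd.le
  have p2 : 0 ≤ (y - x) / (w - x) := div_nonneg (by linarith) hd.le
  have h1 := hf.2 hx hw p1 p2 (by field_simp; ring)
  have h2 := hf.2 hx hw p2 p1 (by field_simp; ring)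
  simp only [smul_eq_mul] at h1 h2
  have e1 : (w - y) / (w - x) * x + (y - x) / (w - x) * w = y := by field_simp; ring
  have e2 : (y - x) / (w - x) * x + (w - y) / (w - x) * w = z := by
    rw [show z = x + w - y by linarith]; field_simp; ring
  have e3 : (w - y) / (w - x) + (y - x) / (w - x) = 1 := by field_simp; ring
  rw [e1] at h1
  rw [e2] at h2
  have : f x + f w = ((w - y) / (w - x) + (y - x) / (w - x)) * f x +
    ((w - y) / (w - x) + (y - x) / (w - x)) * f w := by rw [e3]; ring
  linarith

/-- The input in which the slots outside `I` are replaced by the zero function. -/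
def mask {n : ℕ} (I : Set (ℝ → ℝ)) [DecidablePred (· ∈ I)] (σ : Fin n → ℝ → ℝ) :
    Fin n → ℝ → ℝ :=
  fun t => if σ t ∈ I then σ t else fun _ => 0

section Mask

variable {Δ : ℝ} {n : ℕ} {I : Set (ℝ → ℝ)} [DecidablePred (· ∈ I)]

lemma isConcaveRevenue_mask {σ : Fin n → ℝ → ℝ} (hσ : ∀ t, IsConcaveRevenue Δ (σ t)) (t : Fin n) :
    IsConcaveRevenue Δ (mask I σ t) := by
  unfold mask
  split_ifs
  · exact hσ t
  · exact isConcaveRevenue_zero Δ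

lemma init_mask (σ : Fin (n + 1) → ℝ → ℝ) : Fin.init (mask I σ) = mask I (Fin.init σ) := rfl

/-- Inventory is worth more when more slots are available. -/
lemma offlineOpt_mask_increment_le : ∀ {n : ℕ} {σ : Fin n → ℝ → ℝ},
    (∀ t, IsConcaveRevenue Δ (σ t)) → ∀ {x y : ℝ}, 0 ≤ x → x ≤ y → y ≤ Δ →
    offlineOpt x σ + offlineOpt y (mask I σ) ≤ offlineOpt y σ + offlineOpt x (mask I σ)
  | 0, σ, _, x, y, hx, hxy, _ => by
    simp [offlineOpt_fin_zero hx, offlineOpt_fin_zero (hx.trans hxy)]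
  | n + 1, σ, hσ, x, y, hx, hxy, hy => by
    have hσ' : ∀ t, IsConcaveRevenue Δ (Fin.init σ t) := fun t => hσ t.castSucc
    have hτ := isConcaveRevenue_mask (I := I) hσ
    have hτ' := isConcaveRevenue_mask (I := I) hσ'
    have ih : ∀ {x y : ℝ}, 0 ≤ x → x ≤ y → y ≤ Δ → offlineOpt x (Fin.init σ) +
        offlineOpt y (mask I (Fin.init σ)) ≤ offlineOpt y (Fin.init σ) +
        offlineOpt x (mask I (Fin.init σ)) :=
      fun hx hxy hy => offlineOpt_mask_increment_le hσ' hx hxy hy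
    have hconc := concaveOn_offlineOpt hτ'
    -- An exchange argument: `u` and `w` are the last-slot sales on the left, to be reassigned to
    -- the two optima on the right.
    suffices H : ∀ u ∈ Icc 0 x, ∀ w ∈ Icc 0 y,
        σ (Fin.last n) u + offlineOpt (x - u) (Fin.init σ) +
          (mask I σ (Fin.last n) w + offlineOpt (y - w) (mask I (Fin.init σ))) ≤
        offlineOpt y σ + offlineOpt x (mask I σ) by
      rw [← le_sub_iff_add_le]
      refine offlineOpt_le_of_forall_last hσ ⟨hx, hxy.trans hy⟩ fun u hu => ?_
      rw [le_sub_iff_add_le', ← le_sub_iff_add_le]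
      refine offlineOpt_le_of_forall_last hτ ⟨hx.trans hxy, hy⟩ fun w hw => ?_
      rw [init_mask]
      linarith [H u hu w hw]
    intro u hu w hw
    have A : ∀ u ∈ Icc 0 y, _ := fun u hu => last_add_offlineOpt_init_le hσ hy hu
    have B : ∀ u ∈ Icc 0 x, _ := fun u hu => last_add_offlineOpt_init_le hτ (hxy.trans hy) hu
    rw [init_mask] at B
    by_cases hI : σ (Fin.last n) ∈ I
    · have hlast : mask I σ (Fin.last n) = σ (Fin.last n) := if_pos hI
      rw [hlast] at B ⊢
      rcases le_or_gt w u with hwu | hwu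
      -- The full input keeps `u` and the masked one keeps `w`; the leftovers are compared by
      -- induction and by concavity of the masked optimum.
      · have h1 := A u ⟨hu.1, hu.2.trans hxy⟩
        have h2 := B w ⟨hw.1, hwu.trans hu.2⟩
        have h3 := ih (x := x - u) (y := y - u) (by linarith [hu.2]) (by linarith)
          (by linarith [hu.1])
        have h4 := concaveOn_add_le_add hconc (x := x - u) (y := y - u) (z := x - w) (w := y - w)
          ⟨by linarith [hu.2], by linarith [hu.1]⟩ ⟨by linarith [hw.2], by linarith [hw.1]⟩
          (by linarith) (by linarith) (by ring)
        linarith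
      rcases le_or_gt (x - u) (y - w) with h | h
      -- The two sales trade places, and induction applies to the leftovers `x - u ≤ y - w`.
      · have h1 := A w hw
        have h2 := B u hu
        have h3 := ih (x := x - u) (y := y - w) (by linarith [hu.2]) h (by linarith [hw.1])
        linarith
      -- Shifting the sales by `y - x` leaves exactly `x - u` and `y - w`, so only concavity of the
      -- last revenue function is needed.
      · have h1 := A (u + (y - x)) ⟨by linarith [hu.1], by linarith [hu.2]⟩
        have h2 := B (w - (y - x)) ⟨by linarith [hu.1], by linarith [hw.2]⟩
        have h3 := concaveOn_add_le_add (hσ (Fin.last n)).concaveOn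
          (x := u) (y := u + (y - x)) (z := w - (y - x)) (w := w)
          ⟨hu.1, by linarith [hu.2]⟩ ⟨hw.1, hw.2.trans hy⟩ (by linarith) (by linarith) (by ring)
        rw [show y - (u + (y - x)) = x - u by ring] at h1
        rw [show x - (w - (y - x)) = y - w by ring] at h2
        linarith
    · have hlast : mask I σ (Fin.last n) = fun _ => 0 := if_neg hI
      rw [hlast] at B ⊢
      have h1 := A u ⟨hu.1, hu.2.trans hxy⟩
      have h2 := B 0 ⟨le_rfl, hx⟩
      have h3 := ih (x := x - u) (y := y - u) (by linarith [hu.2]) (by linarith)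
          (by linarith [hu.1])
      have h4 := concaveOn_add_le_add hconc (x := x - u) (y := y - u) (z := x) (w := y)
          ⟨by linarith [hu.2], by linarith [hu.1]⟩ ⟨by linarith, by linarith [hw.1]⟩
          (by linarith) (by linarith [hu.1]) (by ring)
      have h5 := offlineOpt_mono hτ' (x := y - w) (y := y) (by linarith [hw.2])
        (by linarith [hw.1]) hy
      simp only [sub_zero] at h2 h4
      linarith

/-- The offline optimum has decreasing marginal gains: a slot gains at least as much in the masked
input as in the full one. -/
lemma offlineOpt_sub_init_le_mask (hΔ : 0 ≤ Δ) {σ : Fin (n + 1) → ℝ → ℝ}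
    (hσ : ∀ t, IsConcaveRevenue Δ (σ t)) (hI : σ (Fin.last n) ∈ I) :
    offlineOpt Δ σ - offlineOpt Δ (Fin.init σ) ≤
      offlineOpt Δ (mask I σ) - offlineOpt Δ (mask I (Fin.init σ)) := by
  rw [sub_le_iff_le_add]
  refine offlineOpt_le_of_forall_last hσ ⟨hΔ, le_rfl⟩ fun u hu => ?_
  have h1 := offlineOpt_mask_increment_le (I := I) (σ := Fin.init σ) (fun t => hσ t.castSucc)
    (x := Δ - u) (y := Δ) (by linarith [hu.2]) (by linarith [hu.1]) le_rfl
  have h2 := last_add_offlineOpt_init_le (isConcaveRevenue_mask (I := I) hσ) le_rfl hu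
  have hlast : mask I σ (Fin.last n) = σ (Fin.last n) := if_pos hI
  rw [init_mask, hlast] at h2
  linarith

end Mask

/-! ### Increments of the offline optimum. -/

/-- The increase of the offline optimum caused by slot `t`. -/
noncomputable def optIncrement (Δ : ℝ) {T : ℕ} (σ : Fin T → ℝ → ℝ) (t : Fin T) : ℝ :=
  offlineOpt Δ (Fin.take (t + 1) t.isLt σ) - offlineOpt Δ (Fin.take t t.isLt.le σ)

section Increment

variable {Δ : ℝ} {T : ℕ}

lemma optIncrement_castSucc (σ : Fin (T + 1) → ℝ → ℝ) (t : Fin T) :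
    optIncrement Δ σ t.castSucc = optIncrement Δ (Fin.init σ) t := rfl

lemma optIncrement_last (σ : Fin (T + 1) → ℝ → ℝ) :
    optIncrement Δ σ (Fin.last T) = offlineOpt Δ σ - offlineOpt Δ (Fin.init σ) := rfl

lemma optIncrement_eq (σ : Fin T → ℝ → ℝ) (t : Fin T) :
    optIncrement Δ σ t = offlineOpt Δ (Fin.take (t + 1) t.isLt σ) -
      offlineOpt Δ (Fin.init (Fin.take (t + 1) t.isLt σ)) := rfl

lemma optIncrement_nonneg (hΔ : 0 ≤ Δ) {σ : Fin T → ℝ → ℝ} (hσ : ∀ t, IsConcaveRevenue Δ (σ t))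
    (t : Fin T) : 0 ≤ optIncrement Δ σ t := by
  rw [optIncrement_eq, sub_nonneg]
  exact offlineOpt_init_le (fun s => hσ _) ⟨hΔ, le_rfl⟩

lemma optIncrement_le (hΔ : 0 ≤ Δ) {σ : Fin T → ℝ → ℝ} (hσ : ∀ t, IsConcaveRevenue Δ (σ t))
    (t : Fin T) : optIncrement Δ σ t ≤ σ t Δ := by
  rw [optIncrement_eq, sub_le_iff_le_add]
  exact offlineOpt_le_last_add (σ := Fin.take (t + 1) t.isLt σ) (fun s => hσ _) ⟨hΔ, le_rfl⟩

lemma sum_optIncrement (hΔ : 0 ≤ Δ) : ∀ {T : ℕ} (σ : Fin T → ℝ → ℝ),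
    ∑ t, optIncrement Δ σ t = offlineOpt Δ σ
  | 0, σ => by simp [offlineOpt_fin_zero hΔ]
  | T + 1, σ => by
    simp only [Fin.sum_univ_castSucc, optIncrement_castSucc, optIncrement_last]
    rw [sum_optIncrement hΔ]
    ring

/-- Each kept slot gains at least as much in the masked input, where the gains telescope. -/
lemma sum_optIncrement_le_offlineOpt_mask (hΔ : 0 ≤ Δ) (I : Set (ℝ → ℝ))
    [DecidablePred (· ∈ I)] : ∀ {T : ℕ} {σ : Fin T → ℝ → ℝ}, (∀ t, IsConcaveRevenue Δ (σ t)) →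
    ∑ t, (if σ t ∈ I then optIncrement Δ σ t else 0) ≤ offlineOpt Δ (mask I σ)
  | 0, σ, _ => by simp [offlineOpt_fin_zero hΔ]
  | T + 1, σ, hσ => by
    have ih := sum_optIncrement_le_offlineOpt_mask hΔ I (σ := Fin.init σ) fun t => hσ t.castSucc
    rw [Fin.sum_univ_castSucc]
    refine (add_le_add ih le_rfl).trans ?_
    rw [optIncrement_last]
    split_ifs with h
    · have := offlineOpt_sub_init_le_mask hΔ hσ h
      linarith
    · have := offlineOpt_init_le (isConcaveRevenue_mask (I := I) hσ) ⟨hΔ, le_rfl⟩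
      rw [init_mask] at this
      linarith

lemma offlineOpt_le_mul (hΔ : 0 ≤ Δ) {σ : Fin T → ℝ → ℝ} {l : ℝ} (hl : 0 ≤ l)
    (h : ∀ t, ∀ v ∈ Icc 0 Δ, σ t v ≤ l * v) : offlineOpt Δ σ ≤ l * Δ :=
  offlineOpt_le hΔ fun v hv => by
    refine (Finset.sum_le_sum fun t _ => h t _ (mem_Icc_of_mem_feasibleQuantities hv t)).trans ?_
    rw [← Finset.mul_sum]
    exact mul_le_mul_of_nonneg_left hv.2 hl

end Increment

/-! ### Layer-cake decomposition of the reciprocal price. -/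

lemma integral_indicator_sq_inv {m M p : ℝ} (hm : 0 < m) (hp : p ∈ Icc m M) :
    IntervalIntegrable (fun l : ℝ => if p < l then l⁻¹ ^ 2 else 0) MeasureTheory.volume m M ∧
    ∫ l in m..M, (if p < l then l⁻¹ ^ 2 else 0) = 1 / p - 1 / M := by
  have hp0 : 0 < p := hm.trans_le hp.1
  have hne : ∀ l ∈ uIcc p M, l ≠ 0 := fun l hl => by
    rw [uIcc_of_le hp.2] at hl
    exact (hp0.trans_le hl.1).ne'
  have hint : IntervalIntegrable (fun l : ℝ => l⁻¹ ^ 2) MeasureTheory.volume p M :=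
    ContinuousOn.intervalIntegrable ((continuousOn_id.inv₀ hne).pow 2)
  have e1 : EqOn (fun _ => (0 : ℝ)) (fun l : ℝ => if p < l then l⁻¹ ^ 2 else 0) (uIoc m p) := by
    intro l hl
    rw [uIoc_of_le hp.1] at hl
    simp [hl.2]
  have e2 : EqOn (fun l : ℝ => l⁻¹ ^ 2) (fun l : ℝ => if p < l then l⁻¹ ^ 2 else 0)
      (uIoc p M) := by
    intro l hl
    rw [uIoc_of_le hp.2] at hl
    simp [hl.1]
  have i1 : IntervalIntegrable (fun l : ℝ => if p < l then l⁻¹ ^ 2 else 0)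
      MeasureTheory.volume m p := (intervalIntegrable_const (c := (0 : ℝ))).congr e1
  have i2 : IntervalIntegrable (fun l : ℝ => if p < l then l⁻¹ ^ 2 else 0)
      MeasureTheory.volume p M := hint.congr e2
  refine ⟨i1.trans i2, ?_⟩
  rw [← intervalIntegral.integral_add_adjacent_intervals i1 i2,
    ← intervalIntegral.integral_congr_ae (MeasureTheory.ae_of_all _ e1),
    ← intervalIntegral.integral_congr_ae (MeasureTheory.ae_of_all _ e2)]
  rw [intervalIntegral.integral_eq_sub_of_hasDerivAt (f := fun l => -l⁻¹) (fun l hl => ?_) hint]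
  · simp; ring
  · simpa using (hasDerivAt_inv (hne l hl)).fun_neg

/-- If the weights with price below `l` sum to at most `l * Δ` for every `l`, then the weights
divided by their prices sum to at most `Δ * (log (M / m) + 1)`. -/
lemma sum_div_le_of_forall_sum_le {T : ℕ} {a p : Fin T → ℝ} {m M Δ : ℝ} (hm : 0 < m) (hmM : m ≤ M)
    (hp : ∀ t, p t ∈ Icc m M) (htot : ∑ t, a t ≤ M * Δ)
    (h : ∀ l ∈ Icc m M, ∑ t, (if p t < l then a t else 0) ≤ l * Δ) :
    ∑ t, a t / p t ≤ Δ * (Real.log (M / m) + 1) := by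
  have hM : 0 < M := hm.trans_le hmM
  have hI := fun t => integral_indicator_sq_inv hm (hp t)
  have hne : ∀ l ∈ uIcc m M, l ≠ 0 := fun l hl => by
    rw [uIcc_of_le hmM] at hl
    exact (hm.trans_le hl.1).ne'
  have h1 : ∑ t, a t / p t = (∑ t, a t) / M +
      ∫ l in m..M, ∑ t, a t * (if p t < l then l⁻¹ ^ 2 else 0) := by
    rw [intervalIntegral.integral_finsetSum fun t _ => (hI t).1.const_mul (a t), Finset.sum_div,
      ← Finset.sum_add_distrib]
    refine Finset.sum_congr rfl fun t _ => ?_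
    rw [intervalIntegral.integral_const_mul, (hI t).2]
    ring
  have h2 : ∫ l in m..M, ∑ t, a t * (if p t < l then l⁻¹ ^ 2 else 0) ≤
      ∫ l in m..M, Δ * l⁻¹ := by
    refine intervalIntegral.integral_mono_on hmM ?_ ?_ fun l hl => ?_
    · have := IntervalIntegrable.sum Finset.univ (fun t _ => (hI t).1.const_mul (a t))
      simpa only [Finset.sum_fn] using this
    · exact (ContinuousOn.intervalIntegrable (continuousOn_id.inv₀ hne)).const_mul Δ
    · have hl0 : 0 < l := hm.trans_le hl.1
      have e : ∑ t, a t * (if p t < l then l⁻¹ ^ 2 else 0) =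
          (∑ t, (if p t < l then a t else 0)) * l⁻¹ ^ 2 := by
        rw [Finset.sum_mul]
        refine Finset.sum_congr rfl fun t _ => ?_
        split_ifs <;> simp
      rw [e]
      refine (mul_le_mul_of_nonneg_right (h l hl) (by positivity)).trans_eq ?_
      field_simp
  rw [intervalIntegral.integral_const_mul, integral_inv_of_pos hm hM] at h2
  have h3 : (∑ t, a t) / M ≤ Δ := by
    rw [div_le_iff₀ hM]
    linarith
  linarith


/-! ### Revenue functions and the family constant. -/

section RevenueFunction

variable {Δ m M : ℝ} {g : ℝ → ℝ}

lemma IsRevenueFunction.le_basePrice_mul (h : IsRevenueFunction Δ m M g) {v : ℝ}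
    (hv : v ∈ Icc 0 Δ) : g v ≤ basePrice Δ g * v := by
  rcases hv.1.eq_or_lt with rfl | hv0
  · simp [h.map_zero]
  have h0 : (0 : ℝ) ∈ Icc 0 Δ := ⟨le_rfl, hv.1.trans hv.2⟩
  have := h.concaveOn.slope_le_of_hasDerivWithinAt h0 hv hv0
    (h.differentiableOn 0 h0).hasDerivWithinAt
  rw [slope_def_field, h.map_zero, sub_zero, sub_zero, div_le_iff₀ hv0] at this
  exact this

/-- Otherwise the function would vanish on all of `[0, Δ]`, and its base price would be `0 < m`. -/
lemma IsRevenueFunction.pos_of_isMaxOn (h : IsRevenueFunction Δ m M g) (hΔ : 0 < Δ) (hm : 0 < m)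
    {v : ℝ} (hv : IsMaxOn g (Icc 0 Δ) v) : 0 < g v := by
  by_contra! hle
  have hzero : EqOn g (fun _ => 0) (Icc 0 Δ) := fun x hx =>
    le_antisymm ((hv hx).trans hle) (h.isConcaveRevenue.nonneg hx)
  have h1 := h.basePrice_mem.1
  rw [derivWithin_congr hzero (hzero ⟨le_rfl, hΔ.le⟩)] at h1
  simp at h1
  linarith

lemma IsRevenueFunction.maximizer_pos (h : IsRevenueFunction Δ m M g) (hΔ : 0 < Δ) (hm : 0 < m)
    {v : ℝ} (hvm : v ∈ Icc 0 Δ) (hv : IsMaxOn g (Icc 0 Δ) v) : 0 < v := by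
  refine hvm.1.lt_of_ne ?_
  rintro rfl
  exact absurd (h.pos_of_isMaxOn hΔ hm hv) (by simp [h.map_zero])

/-- A revenue function stays strictly below its tangent at `0` in every interior maximizer. -/
lemma IsRevenueFunction.lt_basePrice_mul_of_isMaxOn (h : IsRevenueFunction Δ m M g) (hm : 0 < m)
    {v : ℝ} (hv0 : 0 < v) (hvΔ : v < Δ) (hv : IsMaxOn g (Icc 0 Δ) v) :
    g v < basePrice Δ g * v := by
  refine (h.le_basePrice_mul ⟨hv0.le, hvΔ.le⟩).lt_of_ne fun heq => ?_
  have hnhds : Icc 0 Δ ∈ nhds v := Icc_mem_nhds hv0 hvΔ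
  have hd := ((h.differentiableOn v ⟨hv0.le, hvΔ.le⟩).differentiableAt hnhds).hasDerivAt
  -- If the tangent were touched at `v`, both `g` and `g` minus the tangent would have a local
  -- maximum there, forcing the base price to be `0`.
  have h1 := (hv.isLocalMax hnhds).hasDerivAt_eq_zero hd
  have h2 : IsLocalMax (fun x => g x - basePrice Δ g * x) v := by
    filter_upwards [hnhds] with x hx
    linarith [h.le_basePrice_mul hx]
  have h3 := h2.hasDerivAt_eq_zero (hd.sub ((hasDerivAt_id v).const_mul (basePrice Δ g)))
  have h4 := h.basePrice_mem.1
  change m ≤ basePrice Δ g at h4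
  linarith

end RevenueFunction

section FamilyConstant

variable {Δ m M : ℝ} {G : Set (ℝ → ℝ)} {vhat : (ℝ → ℝ) → ℝ} {g : ℝ → ℝ}

lemma basePrice_mul_le_familyConstant_mul (hc : familyConstant Δ G vhat ≠ ⊤) (hg : g ∈ G)
    (h : 0 < g (vhat g)) (hv : 0 < vhat g) :
    basePrice Δ g * vhat g ≤ (familyConstant Δ G vhat).toReal * g (vhat g) := by
  have h1 : ENNReal.ofReal (basePrice Δ g / (g (vhat g) / vhat g)) ≤ familyConstant Δ G vhat :=
    le_iSup₂ (f := fun g (_ : g ∈ G) =>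
      ENNReal.ofReal (basePrice Δ g / (g (vhat g) / vhat g))) g hg
  have h2 := (ENNReal.ofReal_le_iff_le_toReal hc).1 h1
  rw [div_le_iff₀ (div_pos h hv)] at h2
  have := mul_le_mul_of_nonneg_right h2 hv.le
  rwa [mul_assoc, div_mul_cancel₀ _ hv.ne'] at this

lemma one_le_toReal_familyConstant (hΔ : 0 < Δ) (hm : 0 < m) (hne : G.Nonempty)
    (hG : ∀ g ∈ G, IsRevenueFunction Δ m M g)
    (hvhat : ∀ g ∈ G, vhat g ∈ Icc 0 Δ ∧ IsMaxOn g (Icc 0 Δ) (vhat g))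
    (hc : familyConstant Δ G vhat ≠ ⊤) : 1 ≤ (familyConstant Δ G vhat).toReal := by
  obtain ⟨g, hg⟩ := hne
  have h1 := (hG g hg).pos_of_isMaxOn hΔ hm (hvhat g hg).2
  have h2 := (hG g hg).maximizer_pos hΔ hm (hvhat g hg).1 (hvhat g hg).2
  have h3 := basePrice_mul_le_familyConstant_mul hc hg h1 h2
  have h4 := (hG g hg).le_basePrice_mul (hvhat g hg).1
  exact le_of_mul_le_mul_right (by linarith) h1

end FamilyConstant

/-! ### Existence of CR-Pursuit. -/

section Existence

/-- An online algorithm that solves the defining equation of CR-Pursuit(`π`) whenever possible. -/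
noncomputable def pursuit (Δ π : ℝ) : OnlineAlgorithm
  -- Never read: `decision` always passes at least one revenue function.
  | 0, _ => 0
  | n + 1, σ =>
    open scoped Classical in
    if h : ∃ v ∈ Icc 0 Δ, σ (Fin.last n) v =
        1 / π * (offlineOpt Δ σ - offlineOpt Δ (Fin.init σ)) then h.choose else 0

lemma isCRPursuit_pursuit {Δ π : ℝ} {G : Set (ℝ → ℝ)} (hΔ : 0 ≤ Δ) (hπ : 1 ≤ π)
    (hG : ∀ g ∈ G, IsConcaveRevenue Δ g) (hcont : ∀ g ∈ G, ContinuousOn g (Icc 0 Δ)) :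
    IsCRPursuit Δ G π (pursuit Δ π) := by
  intro T σ hσ t
  have hσ' := fun t => hG _ (hσ t)
  have h0 := optIncrement_nonneg hΔ hσ' t
  -- A slot raises the optimum by at most its full-inventory revenue, so for `π ≥ 1` the
  -- intermediate value theorem applies.
  have hmem : 1 / π * optIncrement Δ σ t ∈ Icc (σ t 0) (σ t Δ) := by
    rw [(hσ' t).map_zero]
    refine ⟨by positivity, (mul_le_of_le_one_left h0 ?_).trans (optIncrement_le hΔ hσ' t)⟩
    rw [div_le_one (by linarith)]
    exact hπ
  have hex : ∃ v ∈ Icc 0 Δ, σ t v = 1 / π * optIncrement Δ σ t :=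
    intermediate_value_Icc hΔ (hcont _ (hσ t)) hmem
  have hdec : decision (pursuit Δ π) σ t = hex.choose := dif_pos hex
  rw [hdec]
  exact hex.choose_spec

end Existence

/-! ### Revenue and inventory use of CR-Pursuit. -/

section Pursuit

variable {Δ m M π : ℝ} {G : Set (ℝ → ℝ)} {A : OnlineAlgorithm} {T : ℕ} {σ : Fin T → ℝ → ℝ}

lemma IsCRPursuit.revenue_eq (hA : IsCRPursuit Δ G π A) (hΔ : 0 ≤ Δ) (hσ : ∀ t, σ t ∈ G) :
    revenue A σ = 1 / π * offlineOpt Δ σ := by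
  rw [← sum_optIncrement hΔ σ, Finset.mul_sum]
  exact Finset.sum_congr rfl fun t _ => (hA T σ hσ t).2

lemma offlineOpt_pos (hΔ : 0 < Δ) (hm : 0 < m) (hG : ∀ g ∈ G, IsRevenueFunction Δ m M g)
    (hT : 0 < T) (hσ : ∀ t, σ t ∈ G) : 0 < offlineOpt Δ σ := by
  obtain ⟨n, rfl⟩ : ∃ n, T = n + 1 := ⟨T - 1, by omega⟩
  have hσ' := fun t => (hG _ (hσ t)).isConcaveRevenue
  have h1 := last_add_offlineOpt_init_le hσ' le_rfl (u := Δ) ⟨hΔ.le, le_rfl⟩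
  have h2 := offlineOpt_nonneg (σ := Fin.init σ) (x := Δ - Δ) (fun t => hσ' t.castSucc)
    (by simp [hΔ.le])
  have h3 := (hG _ (hσ (Fin.last n))).pos_of_isMaxOn hΔ hm (v := Δ) fun x hx =>
    (hσ' (Fin.last n)).monotoneOn hx ⟨hΔ.le, le_rfl⟩ hx.2
  linarith

lemma IsCRPursuit.isCompetitive (hA : IsCRPursuit Δ G π A) (hΔ : 0 < Δ) (hm : 0 < m) (hπ : 0 < π)
    (hne : G.Nonempty) (hG : ∀ g ∈ G, IsRevenueFunction Δ m M g) : IsCompetitive Δ G A π := by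
  have key : ∀ (T : ℕ) (σ : Fin T → ℝ → ℝ), 0 < T → (∀ t, σ t ∈ G) →
      ENNReal.ofReal (offlineOpt Δ σ) / ENNReal.ofReal (revenue A σ) = ENNReal.ofReal π := by
    intro T σ hT hσ
    have h := offlineOpt_pos hΔ hm hG hT hσ
    rw [hA.revenue_eq hΔ.le hσ, ← ENNReal.ofReal_div_of_pos (by positivity)]
    congr 1
    field_simp
  constructor
  · obtain ⟨g, hg⟩ := hne
    exact ⟨1, fun _ => g, one_pos, fun _ => hg, (key 1 _ one_pos fun _ => hg).symm⟩
  · rintro r ⟨T, σ, hT, hσ, rfl⟩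
    exact (key T σ hT hσ).le

/-- In each slot, CR-Pursuit sells at most `c / π` times the increase of the offline optimum divided
by the base price. -/
lemma IsCRPursuit.decision_le (hA : IsCRPursuit Δ G π A) (hΔ : 0 < Δ) (hm : 0 < m)
    {vhat : (ℝ → ℝ) → ℝ} (hG : ∀ g ∈ G, IsRevenueFunction Δ m M g)
    (hvhat : ∀ g ∈ G, vhat g ∈ Icc 0 Δ ∧ IsMaxOn g (Icc 0 Δ) (vhat g))
    (hc : familyConstant Δ G vhat ≠ ⊤) (hc1 : 1 ≤ (familyConstant Δ G vhat).toReal)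
    (hcπ : (familyConstant Δ G vhat).toReal ≤ π) (hσ : ∀ t, σ t ∈ G) (t : Fin T) :
    decision A σ t ≤ (familyConstant Δ G vhat).toReal / π *
      (optIncrement Δ σ t / basePrice Δ (σ t)) := by
  obtain ⟨hv, hveq⟩ := hA T σ hσ t
  change _ = 1 / π * optIncrement Δ σ t at hveq
  set v := decision A σ t
  set c := (familyConstant Δ G vhat).toReal
  set g := σ t with hg
  have hgG : g ∈ G := hσ t
  have hrev := hG g hgG
  have hp : 0 < basePrice Δ g := hm.trans_le hrev.basePrice_mem.1
  have hπ : 0 < π := by linarith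
  obtain ⟨hmem, hmax⟩ := hvhat g hgG
  have hpos := hrev.pos_of_isMaxOn hΔ hm hmax
  have hvpos := hrev.maximizer_pos hΔ hm hmem hmax
  have hcg := basePrice_mul_le_familyConstant_mul hc hgG hpos hvpos
  suffices basePrice Δ g * v ≤ c * g v by
    rw [div_mul_div_comm, le_div_iff₀ (by positivity)]
    have h2 : optIncrement Δ σ t = π * g v := by rw [hveq]; field_simp
    rw [h2]
    nlinarith
  -- Up to the maximizer, `g` lies above its chord from `0`. Beyond it, `π * g v ≤ g Δ ≤ g v` forces
  -- `π = c = 1`, so `g` would touch its tangent at an interior maximizer.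
  rcases le_or_gt v (vhat g) with hle | hlt
  · have h0 : (0 : ℝ) ∈ Icc 0 Δ := ⟨le_rfl, hΔ.le⟩
    have p1 : 0 ≤ 1 - v / vhat g := by
      rw [sub_nonneg, div_le_one hvpos]; exact hle
    have p2 : 0 ≤ v / vhat g := div_nonneg hv.1 hvpos.le
    have h1 := hrev.concaveOn.2 h0 hmem p1 p2 (by ring)
    simp only [smul_eq_mul, hrev.map_zero, mul_zero, zero_add, div_mul_cancel₀ _ hvpos.ne'] at h1
    calc basePrice Δ g * v = v / vhat g * (basePrice Δ g * vhat g) := by field_simp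
      _ ≤ v / vhat g * (c * g (vhat g)) := mul_le_mul_of_nonneg_left hcg p2
      _ = c * (v / vhat g * g (vhat g)) := by ring
      _ ≤ c * g v := mul_le_mul_of_nonneg_left h1 (by linarith)
  · exfalso
    have h1 : g (vhat g) ≤ g v := hrev.monotoneOn hmem hv hlt.le
    have h2 := optIncrement_le hΔ.le (fun t => (hG _ (hσ t)).isConcaveRevenue) t
    have h3 : g Δ ≤ g (vhat g) := hmax ⟨hΔ.le, le_rfl⟩
    have h4 : π * g v = optIncrement Δ σ t := by rw [hveq]; field_simp
    have h5 : π ≤ 1 := by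
      refine le_of_mul_le_mul_right (a := g v) ?_ (by linarith)
      rw [← hg] at h2
      linarith
    have h6 : c = 1 := by linarith
    change _ ≤ c * _ at hcg
    rw [h6, one_mul] at hcg
    exact absurd (hrev.lt_basePrice_mul_of_isMaxOn hm hvpos (hlt.trans_le hv.2) hmax)
      (not_lt.2 hcg)

lemma sum_optIncrement_div_basePrice_le (hΔ : 0 ≤ Δ) (hm : 0 < m) (hmM : m ≤ M)
    (hG : ∀ g ∈ G, IsRevenueFunction Δ m M g) (hσ : ∀ t, σ t ∈ G) :
    ∑ t, optIncrement Δ σ t / basePrice Δ (σ t) ≤ Δ * (Real.log (M / m) + 1) := by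
  classical
  have hσ' := fun t => (hG _ (hσ t)).isConcaveRevenue
  refine sum_div_le_of_forall_sum_le hm hmM (fun t => (hG _ (hσ t)).basePrice_mem) ?_ ?_
  · rw [sum_optIncrement hΔ]
    exact offlineOpt_le_mul hΔ (by linarith) fun t v hv =>
      ((hG _ (hσ t)).le_basePrice_mul hv).trans
        (mul_le_mul_of_nonneg_right (hG _ (hσ t)).basePrice_mem.2 hv.1)
  · intro l hl
    have hl0 : 0 ≤ l := hm.le.trans hl.1
    refine (sum_optIncrement_le_offlineOpt_mask hΔ {g | basePrice Δ g < l} hσ').trans ?_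
    refine offlineOpt_le_mul hΔ hl0 fun t v hv => ?_
    unfold mask
    split_ifs with h
    · exact ((hG _ (hσ t)).le_basePrice_mul hv).trans
        (mul_le_mul_of_nonneg_right (le_of_lt h) hv.1)
    · exact mul_nonneg hl0 hv.1

lemma IsCRPursuit.totalSold_le (hA : IsCRPursuit Δ G π A) (hΔ : 0 < Δ) (hm : 0 < m) (hmM : m ≤ M)
    {vhat : (ℝ → ℝ) → ℝ} (hG : ∀ g ∈ G, IsRevenueFunction Δ m M g)
    (hvhat : ∀ g ∈ G, vhat g ∈ Icc 0 Δ ∧ IsMaxOn g (Icc 0 Δ) (vhat g))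
    (hc : familyConstant Δ G vhat ≠ ⊤) (hc1 : 1 ≤ (familyConstant Δ G vhat).toReal)
    (hπ : π = (familyConstant Δ G vhat).toReal * (Real.log (M / m) + 1))
    (hσ : ∀ t, σ t ∈ G) : totalSold A σ ≤ Δ := by
  have hlog : 0 ≤ Real.log (M / m) := Real.log_nonneg ((one_le_div hm).2 hmM)
  have hcπ : (familyConstant Δ G vhat).toReal ≤ π := by rw [hπ]; nlinarith
  have h := sum_optIncrement_div_basePrice_le hΔ.le hm hmM hG hσ
  set c := (familyConstant Δ G vhat).toReal
  have hc0 : 0 ≤ c / π := div_nonneg (by linarith) (by linarith)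
  calc totalSold A σ
      ≤ ∑ t, c / π * (optIncrement Δ σ t / basePrice Δ (σ t)) :=
        Finset.sum_le_sum fun t _ => hA.decision_le hΔ hm hG hvhat hc hc1 hcπ hσ t
    _ = c / π * ∑ t, optIncrement Δ σ t / basePrice Δ (σ t) := by rw [Finset.mul_sum]
    _ ≤ c / π * (Δ * (Real.log (M / m) + 1)) := mul_le_mul_of_nonneg_left h hc0
    _ = Δ := by
      rw [hπ]
      have : Real.log (M / m) + 1 ≠ 0 := by positivity
      field_simp

end Pursuit

/-! ### The lower bound from rising prices. -/

section LowerBound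

variable {Δ m M : ℝ} {G : Set (ℝ → ℝ)} {A : OnlineAlgorithm}

/-- The quantities that `A` sells on an infinite stream of revenue functions. -/
def streamDecision (A : OnlineAlgorithm) (s : ℕ → ℝ → ℝ) (j : ℕ) : ℝ :=
  A (j + 1) fun i => s i

lemma totalSold_stream (s : ℕ → ℝ → ℝ) (n : ℕ) :
    totalSold A (fun i : Fin n => s i) = ∑ j ∈ Finset.range n, streamDecision A s j :=
  Fin.sum_univ_eq_sum_range (streamDecision A s) n

lemma revenue_stream (s : ℕ → ℝ → ℝ) (n : ℕ) :
    revenue A (fun i : Fin n => s i) = ∑ j ∈ Finset.range n, s j (streamDecision A s j) :=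
  Fin.sum_univ_eq_sum_range (fun j => s j (streamDecision A s j)) n

lemma revenue_pos_and_offlineOpt_le (hr : competitiveRatio Δ G A ≠ ⊤) {T : ℕ} (hT : 0 < T)
    {σ : Fin T → ℝ → ℝ} (hσ : ∀ t, σ t ∈ G) (hpos : 0 < offlineOpt Δ σ) :
    0 < revenue A σ ∧ offlineOpt Δ σ ≤ (competitiveRatio Δ G A).toReal * revenue A σ := by
  have h1 : ENNReal.ofReal (offlineOpt Δ σ) / ENNReal.ofReal (revenue A σ) ≤
      competitiveRatio Δ G A := le_sSup ⟨T, σ, hT, hσ, rfl⟩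
  have hrev : 0 < revenue A σ := by
    by_contra! hle
    rw [ENNReal.ofReal_of_nonpos hle, ENNReal.div_zero (by simpa using hpos)] at h1
    exact hr (top_le_iff.1 h1)
  refine ⟨hrev, ?_⟩
  rw [← ENNReal.ofReal_div_of_pos hrev, ENNReal.ofReal_le_iff_le_toReal hr,
    div_le_iff₀ hrev] at h1
  exact h1

/-- Summation by parts along increasing prices `p` when the revenue after each sale is at least
`b` times the current price. -/
lemma mul_sum_le_sum_sub {p v : ℕ → ℝ} {b : ℝ} (n : ℕ) (hp : ∀ j, 0 < p j)
    (hmono : ∀ j, p j ≤ p (j + 1))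
    (h : ∀ k < n, b * p k ≤ ∑ j ∈ Finset.range (k + 1), p j * v j) :
    b * ∑ j ∈ Finset.range n, (1 - p j / p (j + 1)) ≤
      ∑ j ∈ Finset.range (n + 1), v j - (∑ j ∈ Finset.range (n + 1), p j * v j) / p n := by
  induction n with
  | zero => simp [(hp 0).ne']
  | succ n ih =>
    have h1 := ih fun k hk => h k (by omega)
    have h2 := h n (by omega)
    rw [Finset.sum_range_succ, Finset.sum_range_succ _ (n + 1), Finset.sum_range_succ _ (n + 1)]
    set R := ∑ j ∈ Finset.range (n + 1), p j * v j
    have h3 : (R + p (n + 1) * v (n + 1)) / p (n + 1) = R / p (n + 1) + v (n + 1) := by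
      have := (hp (n + 1)).ne'
      field_simp
    have h4 : 0 ≤ 1 / p n - 1 / p (n + 1) :=
      sub_nonneg.2 (one_div_le_one_div_of_le (hp n) (hmono n))
    -- Raising the price from `p n` to `p (n + 1)` lowers revenue over price by `R * (1 / p n - 1 /
    -- p (n + 1))`, which the revenue bound controls from below.
    have h5 := mul_le_mul_of_nonneg_right h2 h4
    have h6 : b * p n * (1 / p n - 1 / p (n + 1)) = b * (1 - p n / p (n + 1)) := by
      have := (hp n).ne'
      field_simp
    have h7 : R * (1 / p n - 1 / p (n + 1)) = R / p n - R / p (n + 1) := by ring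
    rw [h3, mul_add]
    linarith

lemma le_competitiveRatio_of_prices (hΔ : 0 < Δ)
    (hG : ∀ g ∈ G, IsRevenueFunction Δ m M g)
    (hlin : ∀ p ∈ Icc m M, ∃ g ∈ G, EqOn g (fun v => p * v) (Icc 0 Δ))
    (hA : Respects Δ G A) (hr : competitiveRatio Δ G A ≠ ⊤) {p : ℕ → ℝ} (n : ℕ)
    (hp : ∀ j, 0 < p j) (hmono : ∀ j, p j ≤ p (j + 1)) (hmem : ∀ j ≤ n, p j ∈ Icc m M) :
    1 + ∑ j ∈ Finset.range n, (1 - p j / p (j + 1)) ≤ (competitiveRatio Δ G A).toReal := by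
  choose! f hfG hf using hlin
  let s : ℕ → ℝ → ℝ := fun j => f (p j)
  let v := streamDecision A s
  set r := (competitiveRatio Δ G A).toReal with hrdef
  have hsG : ∀ k ≤ n, ∀ t : Fin (k + 1), s t ∈ G := fun k hk t =>
    hfG _ (hmem _ (by omega))
  have hresp : ∀ k ≤ n, v k ∈ Icc 0 Δ := fun k hk => by
    obtain ⟨h1, h2⟩ := hA (k + 1) (fun i => s i) (hsG k hk)
    have h3 := Finset.single_le_sum (fun i _ => h1 i) (Finset.mem_univ (Fin.last k))
    exact ⟨h1 (Fin.last k), h3.trans h2⟩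
  have hrev : ∀ k ≤ n, revenue A (fun i : Fin (k + 1) => s i) =
      ∑ j ∈ Finset.range (k + 1), p j * v j := fun k hk => by
    rw [revenue_stream]
    refine Finset.sum_congr rfl fun j hj => ?_
    have hj' : j ≤ n := by
      have := Finset.mem_range.1 hj
      omega
    exact hf _ (hmem j hj') (hresp j hj')
  -- Offline, the whole inventory can be sold at the latest price.
  have hopt : ∀ k ≤ n, p k * Δ ≤ offlineOpt Δ (fun i : Fin (k + 1) => s i) := fun k hk => by
    have hσ' : ∀ t : Fin (k + 1), IsConcaveRevenue Δ (s t) := fun t =>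
      (hG _ (hsG k hk t)).isConcaveRevenue
    have h1 := last_add_offlineOpt_init_le hσ' le_rfl (u := Δ) ⟨hΔ.le, le_rfl⟩
    have h2 := offlineOpt_nonneg (σ := Fin.init fun i : Fin (k + 1) => s i) (x := Δ - Δ)
      (fun t => hσ' t.castSucc) (by simp [hΔ.le])
    have h3 : s (Fin.last k : Fin (k + 1)) Δ = p k * Δ := hf _ (hmem k hk) ⟨hΔ.le, le_rfl⟩
    linarith
  have hcomp : ∀ k ≤ n, 0 < ∑ j ∈ Finset.range (k + 1), p j * v j ∧
      p k * Δ ≤ r * ∑ j ∈ Finset.range (k + 1), p j * v j := fun k hk => by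
    have h1 : 0 < p k * Δ := mul_pos (hp k) hΔ
    have h2 := revenue_pos_and_offlineOpt_le hr k.succ_pos (hsG k hk)
      (h1.trans_le (hopt k hk))
    rw [hrev k hk] at h2
    exact ⟨h2.1, (hopt k hk).trans h2.2⟩
  have hr0 : 0 < r := by
    have h1 := hcomp n le_rfl
    exact pos_of_mul_pos_left ((mul_pos (hp n) hΔ).trans_le h1.2) h1.1.le
  have hle : ∀ k ≤ n, Δ / r * p k ≤ ∑ j ∈ Finset.range (k + 1), p j * v j := fun k hk => by
    rw [div_mul_eq_mul_div, div_le_iff₀ hr0]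
    linarith [(hcomp k hk).2]
  have h1 := mul_sum_le_sum_sub n hp hmono fun k hk => hle k hk.le
  have h2 : Δ / r ≤ (∑ j ∈ Finset.range (n + 1), p j * v j) / p n := by
    rw [le_div_iff₀ (hp n)]
    exact hle n le_rfl
  have h3 := (hA (n + 1) (fun i => s i) (hsG n le_rfl)).2
  rw [totalSold_stream] at h3
  have h4 : Δ / r * (1 + ∑ j ∈ Finset.range n, (1 - p j / p (j + 1))) ≤ Δ := by
    rw [mul_add, mul_one]
    change ∑ j ∈ Finset.range (n + 1), v j ≤ Δ at h3
    linarith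
  rw [div_mul_eq_mul_div, div_le_iff₀ hr0] at h4
  exact le_of_mul_le_mul_left h4 hΔ

lemma log_add_one_le_competitiveRatio (hΔ : 0 < Δ) (hm : 0 < m) (hmM : m ≤ M)
    (hG : ∀ g ∈ G, IsRevenueFunction Δ m M g)
    (hlin : ∀ p ∈ Icc m M, ∃ g ∈ G, EqOn g (fun v => p * v) (Icc 0 Δ))
    (hA : Respects Δ G A) :
    ENNReal.ofReal (Real.log (M / m) + 1) ≤ competitiveRatio Δ G A := by
  by_cases hr : competitiveRatio Δ G A = ⊤
  · simp [hr]
  rw [ENNReal.ofReal_le_iff_le_toReal hr]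
  have hM : 0 < M := hm.trans_le hmM
  set L := Real.log (M / m) with hL
  have hL0 : 0 ≤ L := Real.log_nonneg ((one_le_div hm).2 hmM)
  have hexp : m * Real.exp L = M := by
    rw [hL, Real.exp_log (div_pos hM hm)]
    field_simp
  -- The grid has `n + 1` steps of ratio `exp x`; bounding `exp (-x)` by `1 / (1 + x)` makes the
  -- limit elementary.
  have hn : ∀ n : ℕ, 1 + L / (1 + L / ((n : ℝ) + 1)) ≤ (competitiveRatio Δ G A).toReal := by
    intro n
    set x := L / ((n : ℝ) + 1) with hx
    have hx0 : 0 ≤ x := by positivity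
    have hxL : ((n : ℝ) + 1) * x = L := by rw [hx]; field_simp
    let p : ℕ → ℝ := fun j => m * Real.exp (j * x)
    have hquot : ∀ j, p j / p (j + 1) = Real.exp (-x) := fun j => by
      have : p (j + 1) = p j * Real.exp x := by
        simp only [p]
        rw [mul_assoc, ← Real.exp_add]
        push_cast
        ring_nf
      have hpj : p j ≠ 0 := by positivity
      rw [this, Real.exp_neg]
      field_simp
    have hmono : Monotone p := fun i j hij => by
      have : (i : ℝ) * x ≤ j * x := mul_le_mul_of_nonneg_right (by exact_mod_cast hij) hx0
      exact mul_le_mul_of_nonneg_left (Real.exp_le_exp.2 this) hm.le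
    have hp0 : p 0 = m := by simp [p]
    have hpn : p (n + 1) = M := by
      simp only [p]
      rw [Nat.cast_succ, hxL, hexp]
    have key := le_competitiveRatio_of_prices hΔ hG hlin hA hr (p := p) (n + 1)
      (fun j => by positivity) (fun j => hmono j.le_succ)
      (fun j hj => ⟨hp0 ▸ hmono j.zero_le, hpn ▸ hmono hj⟩)
    simp only [hquot, Finset.sum_const, Finset.card_range, nsmul_eq_mul, Nat.cast_succ] at key
    refine le_trans ?_ key
    have h1 : Real.exp (-x) ≤ 1 / (1 + x) := by
      rw [Real.exp_neg, ← one_div]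
      exact one_div_le_one_div_of_le (by linarith) (by linarith [Real.add_one_le_exp x])
    have h2 : L / (1 + x) = ((n : ℝ) + 1) * (1 - 1 / (1 + x)) := by
      rw [← hxL]
      field_simp
      ring
    rw [h2]
    gcongr
  have hlim : Filter.Tendsto (fun n : ℕ => 1 + L / (1 + L / ((n : ℝ) + 1))) Filter.atTop
      (nhds (1 + L / (1 + 0))) := by
    refine tendsto_const_nhds.add (tendsto_const_nhds.div (tendsto_const_nhds.add ?_) (by simp))
    exact tendsto_const_nhds.div_atTop
      (Filter.tendsto_atTop_add_const_right _ _ tendsto_natCast_atTop_atTop)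
  have := le_of_tendsto' hlim hn
  rw [add_zero, div_one] at this
  linarith

end LowerBound

end OOIC

/-! ### Assembly of the bounds. -/

theorem theorem8 (Δ m M : ℝ) (hΔ : 0 < Δ) (hm : 0 < m) (hmM : m ≤ M)
    (G : Set (ℝ → ℝ)) (hne : G.Nonempty) (hG : ∀ g ∈ G, OOIC.IsRevenueFunction Δ m M g)
    (vhat : (ℝ → ℝ) → ℝ)
    (hvhat : ∀ g ∈ G, vhat g ∈ Set.Icc 0 Δ ∧ IsMaxOn g (Set.Icc 0 Δ) (vhat g)) :
    ((∀ p ∈ Set.Icc m M, ∃ g ∈ G, Set.EqOn g (fun v => p * v) (Set.Icc 0 Δ)) →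
      ENNReal.ofReal (Real.log (M / m) + 1) ≤ OOIC.optimalRatio Δ G) ∧
    OOIC.optimalRatio Δ G ≤
      OOIC.familyConstant Δ G vhat * ENNReal.ofReal (Real.log (M / m) + 1) ∧
    (OOIC.familyConstant Δ G vhat ≠ ⊤ →
      ∀ π : ℝ, π = (OOIC.familyConstant Δ G vhat).toReal * (Real.log (M / m) + 1) →
        (∃ A : OOIC.OnlineAlgorithm, OOIC.IsCRPursuit Δ G π A) ∧
        OOIC.CRPursuitFeasible Δ G π ∧
        ∀ A : OOIC.OnlineAlgorithm, OOIC.IsCRPursuit Δ G π A →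
          OOIC.Respects Δ G A ∧ OOIC.IsCompetitive Δ G A π) := by
  have hlog : 0 ≤ Real.log (M / m) := Real.log_nonneg ((one_le_div hm).2 hmM)
  have main : OOIC.familyConstant Δ G vhat ≠ ⊤ →
      ∀ π : ℝ, π = (OOIC.familyConstant Δ G vhat).toReal * (Real.log (M / m) + 1) →
        (∃ A : OOIC.OnlineAlgorithm, OOIC.IsCRPursuit Δ G π A) ∧
        OOIC.CRPursuitFeasible Δ G π ∧
        ∀ A : OOIC.OnlineAlgorithm, OOIC.IsCRPursuit Δ G π A →
          OOIC.Respects Δ G A ∧ OOIC.IsCompetitive Δ G A π := by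
    intro hc π hπ
    have hc1 := OOIC.one_le_toReal_familyConstant hΔ hm hne hG hvhat hc
    have hπ1 : 1 ≤ π := by rw [hπ]; nlinarith
    refine ⟨⟨_, OOIC.isCRPursuit_pursuit hΔ.le hπ1 (fun g hg => (hG g hg).isConcaveRevenue)
      fun g hg => (hG g hg).differentiableOn.continuousOn⟩, ?_, fun A hA => ⟨?_, ?_⟩⟩
    · refine sSup_le ?_
      rintro _ ⟨A, T, σ, hA, hσ, rfl⟩
      exact EReal.coe_le_coe_iff.2 (hA.totalSold_le hΔ hm hmM hG hvhat hc hc1 hπ hσ)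
    · exact fun T σ hσ => ⟨fun t => (hA T σ hσ t).1.1,
        hA.totalSold_le hΔ hm hmM hG hvhat hc hc1 hπ hσ⟩
    · exact hA.isCompetitive hΔ hm (by linarith) hne hG
  refine ⟨fun hlin => ?_, ?_, main⟩
  · refine le_sInf ?_
    rintro _ ⟨A, hA, rfl⟩
    exact OOIC.log_add_one_le_competitiveRatio hΔ hm hmM hG hlin hA
  · by_cases hc : OOIC.familyConstant Δ G vhat = ⊤
    · rw [hc, ENNReal.top_mul (by simp; linarith)]
      exact le_top
    · obtain ⟨⟨A, hA⟩, -, h⟩ := main hc _ rfl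
      obtain ⟨hresp, hcomp⟩ := h A hA
      have h1 : OOIC.optimalRatio Δ G ≤ OOIC.competitiveRatio Δ G A := sInf_le ⟨A, hresp, rfl⟩
      refine h1.trans_eq ?_
      rw [OOIC.competitiveRatio, hcomp.csSup_eq, ENNReal.ofReal_mul ENNReal.toReal_nonneg,
        ENNReal.ofReal_toReal hc]
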